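/- Let $\Bbbk$ be a field, let $G$ be a finite simple graph, and let $\pi=\{W_1,\ldots,W_r\}$ be a clique partition of $G$, i.e. $W_1,\ldots,W_r$ are pairwise disjoint cliques of $G$ with $W_1\cup\cdots\cup W_r=V(G)$. Let $n_1,\ldots,n_r$ be positive integers. The multi-clique-whiskered graph $G^{\pi}[n_1,\ldots,n_r]$ is the graph with vertex set $V(G)\cup\{w_{i,k} : 1\le i\le r,\ 1\le k\le n_i\}$ (the $w_{i,k}$ being new, distinct vertices) and edge set $$E(G)\cup\bigcup_{1\le i\le r}\bigl\{\{x,w_{i,k}\} : x\in W_i,\ 1\le k\le n_i\bigr\}.$$ Let $S=\Bbbk[V(G^{\pi}[n_1,\ldots,n_r])]$ be the polynomial ring whose variables are the vertices of $G^{\pi}[n_1,\ldots,n_r]$, and let $I=I(G^{\pi}[n_1,\ldots,n_r])\subseteq S$ be its edge ideal, generated by the monomials $uv$ for the edges $\{u,v\}$. Then $$\operatorname{pd}_S\, S/I=\operatorname{bight} I,$$ where $\operatorname{pd}_S$ denotes projective dimension over $S$ and the big height $\operatorname{bight} I$ is the maximum of the heights of the minimal prime ideals of $I$. -/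

import Mathlib

/-- A clique partition `π = {W₁, …, W_r}` of `G`: cliques of `G`, pairwise disjoint, with union the
vertex set. (Empty blocks are allowed, which only makes statements about all clique partitions
more general.) -/
structure CliquePartition {V : Type*} (G : SimpleGraph V) (r : ℕ) where
  block : Fin r → Set V
  isClique : ∀ i, G.IsClique (block i)
  disjoint : ∀ i j, i ≠ j → Disjoint (block i) (block j)
  union : (⋃ i, block i) = Set.univ

/-- The multi-clique-whiskered graph `G^π[n₁, …, n_r]`: the vertices are those of `G`
(as `Sum.inl x`) together with new vertices `w_{i,k}`, `k < n i` (as `Sum.inr ⟨i, k⟩`);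
the edges are those of `G` together with all `{x, w_{i,k}}` for `x` in the `i`-th block. -/
def multiCliqueWhiskered {V : Type*} {G : SimpleGraph V} {r : ℕ} (π : CliquePartition G r)
    (n : Fin r → ℕ) : SimpleGraph (V ⊕ (Σ i : Fin r, Fin (n i))) where
  Adj
    | Sum.inl x, Sum.inl y => G.Adj x y
    | Sum.inl x, Sum.inr w => x ∈ π.block w.1
    | Sum.inr w, Sum.inl x => x ∈ π.block w.1
    | Sum.inr _, Sum.inr _ => False
  symm := ⟨by
    rintro (x | w) (y | w') h
    · exact SimpleGraph.Adj.symm (G := G) h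
    · exact h
    · exact h
    · exact h⟩
  loopless := ⟨by
    rintro (x | w) h
    · exact SimpleGraph.irrefl G h
    · exact h⟩

/-- The edge ideal of a graph `H` in the polynomial ring over `k` on the vertices of `H`. -/
noncomputable def edgeIdeal (k : Type*) [CommSemiring k] {V : Type*} (H : SimpleGraph V) :
    Ideal (MvPolynomial V k) :=
  Ideal.span {f | ∃ u v, H.Adj u v ∧ f = MvPolynomial.X u * MvPolynomial.X v}

/-- The big height of an ideal: the largest height of a minimal prime of the ideal. -/
noncomputable def bigHeight {R : Type*} [CommRing R] (I : Ideal R) : ℕ∞ :=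
  ⨆ P ∈ I.minimalPrimes, P.height

/-! ### Depth bounds: regular sequences and vanishing of Ext -/

section ExtVanishing

open CategoryTheory Abelian RingTheory.Sequence Module

universe u

variable {R : Type u} [CommRing R]

/-! Lower bound, valid for every finite graph: a minimal prime `P` of an edge ideal is generated by
the variables it contains and is the annihilator of some element of `S/I`. That nonzero element is
killed by a regular sequence of variables of length at least `P.height`, so
`length_le_projectiveDimension` applies.

Upper bound: for a vertex `x`, the exact sequence of multiplication by `x` bounds `pd S/I` by the
larger of `pd (H - x) + 1` and `pd (H - N[x]) + |N(x)|`. If `x` lies in `G`, both deletions leave,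
up to isolated vertices, a smaller set `W` of vertices of `G` with all the whiskers, because the
blocks are cliques. Induction on `|W|` bounds `pd` by the largest `whiskerCover π n W B` over
independent `B ⊆ W`. For `W = V(G)` these covers are minimal vertex covers, so their sizes are
heights of minimal primes. -/

/-- Multiplication by the first element `a` is injective on `Ext N M (i + 1)`, since `Ext N (M/aM)
i` vanishes by induction; it is also zero, since `a` kills `N`. -/
theorem subsingleton_ext_of_isWeaklyRegular (N : ModuleCat.{u} R) (rs : List R)
    (hN : ∀ r ∈ rs, r ∈ Module.annihilator R N) (M : ModuleCat.{u} R)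
    (reg : IsWeaklyRegular M rs) (i : ℕ) (hi : i < rs.length) : Subsingleton (Ext N M i) := by
  induction rs generalizing M i with
  | nil => simp at hi
  | cons a rs ih =>
    rw [isWeaklyRegular_cons_iff] at reg
    simp only [List.mem_cons, forall_eq_or_imp] at hN
    match i with
    | 0 =>
      have : Subsingleton (N →ₗ[R] M) :=
        IsSMulRegular.linearMap_subsingleton_of_mem_annihilator reg.1 hN.1
      exact (Ext.addEquiv₀.trans ModuleCat.homAddEquiv).subsingleton
    | i + 1 =>
      let g := AddCommGrpCat.ofHom ((Ext.mk₀ (M.smulShortComplex a).f).postcomp N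
          (add_zero (i + 1)))
      have mono_g : Mono g := by
        apply (Ext.covariant_sequence_exact₁' N reg.1.smulShortComplex_shortExact i (i + 1)
          rfl).mono_g ((AddCommGrpCat.isZero_of_iff_subsingleton.mpr ?_).eq_zero_of_src _)
        exact ih hN.2 (ModuleCat.of R (QuotSMulTop a M)) reg.2 i (by simpa using hi)
      have zero_g : g = 0 := Ext.postcomp_smul_id_eq_zero_of_mem_annihilator hN.1 (i + 1)
      exact AddCommGrpCat.subsingleton_of_isZero (Limits.IsZero.of_mono_eq_zero _ zero_g)

theorem isWeaklyRegular_of_projective {rs : List R} (reg : IsWeaklyRegular R rs)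
    (M : Type*) [AddCommGroup M] [Module R M] [Module.Projective R M] : IsWeaklyRegular M rs :=
  ((TensorProduct.rid R M).isWeaklyRegular_congr rs).mp reg.isWeaklyRegular_lTensor

/-- Dimension shifting along `0 → K → P → M → 0`: the group sits between `Ext N P i` and `Ext N K (i
+ 1)`. -/
theorem subsingleton_ext_of_hasProjectiveDimensionLE (N : ModuleCat.{u} R) (rs : List R)
    (hN : ∀ r ∈ rs, r ∈ Module.annihilator R N) (reg : IsWeaklyRegular R rs) (d : ℕ)
    (M : ModuleCat.{u} R) (hM : HasProjectiveDimensionLE M d) (i : ℕ) (hi : i + d < rs.length) :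
    Subsingleton (Ext N M i) := by
  induction d generalizing M i with
  | zero =>
    have : Projective M := (projective_iff_hasProjectiveDimensionLE_zero M).mpr hM
    have : Module.Projective R M := (IsProjective.iff_projective M).mpr this
    exact subsingleton_ext_of_isWeaklyRegular N rs hN M (isWeaklyRegular_of_projective reg M) i hi
  | succ d ih =>
    have hS := M.shortExact_projectiveShortComplex
    have hproj : Projective M.projectiveShortComplex.X₂ := inferInstance
    have h₁ := ih M.projectiveShortComplex.X₁
      ((hS.hasProjectiveDimensionLT_X₃_iff d hproj).mp hM) (i + 1) (by omega)
    have : Module.Projective R M.projectiveShortComplex.X₂ := Module.Projective.of_free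
    have h₂ := subsingleton_ext_of_isWeaklyRegular N rs hN _
      (isWeaklyRegular_of_projective reg M.projectiveShortComplex.X₂) i (by omega)
    have zero1 := AddCommGrpCat.isZero_of_iff_subsingleton.mpr h₂
    have zero2 := AddCommGrpCat.isZero_of_iff_subsingleton.mpr h₁
    exact AddCommGrpCat.subsingleton_of_isZero <| ShortComplex.Exact.isZero_of_both_zeros
        ((Ext.covariant_sequence_exact₃' N hS) i (i + 1) rfl)
        (zero1.eq_zero_of_src _) (zero2.eq_zero_of_tgt _)

/-- A module with a nonzero element killed by a regular sequence of length `n` has projective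
dimension at least `n`. -/
theorem length_le_projectiveDimension (rs : List R) (reg : IsWeaklyRegular R rs)
    (M : ModuleCat.{u} R) (m : M) (hm : m ≠ 0) (hrs : ∀ r ∈ rs, r • m = 0) :
    (rs.length : WithBot ℕ∞) ≤ projectiveDimension M := by
  rw [show (rs.length : WithBot ℕ∞) = ((rs.length : ℕ) : WithBot ℕ∞) from rfl,
    projectiveDimension_ge_iff]
  intro h
  obtain h0 | ⟨d, hd⟩ : rs.length = 0 ∨ ∃ d, rs.length = d + 1 := by cases rs <;> simp
  · rw [h0, hasProjectiveDimensionLT_zero_iff_isZero, ModuleCat.isZero_iff_subsingleton] at h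
    exact hm (Subsingleton.elim _ _)
  · rw [hd] at h
    -- If the dimension were at most `d`, degree `0` would give `Hom(Rm, M) = 0`, contradicting the
    -- inclusion of `Rm`.
    let N := ModuleCat.of R (R ∙ m)
    have := subsingleton_ext_of_hasProjectiveDimensionLE N rs (fun r hr => by
      rw [Module.mem_annihilator]
      rintro ⟨x, hx⟩
      obtain ⟨a, rfl⟩ := Submodule.mem_span_singleton.mp hx
      refine Subtype.ext ?_
      change r • a • m = 0
      rw [smul_comm, hrs r hr, smul_zero]) reg _ M h 0 (by omega)
    have : Subsingleton (N →ₗ[R] M) :=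
      (Ext.addEquiv₀.trans ModuleCat.homAddEquiv).symm.subsingleton
    have h0 := LinearMap.congr_fun (Subsingleton.elim (R ∙ m).subtype 0)
      ⟨m, Submodule.mem_span_singleton_self m⟩
    exact hm h0

end ExtVanishing

/-! ### The exact sequence of a colon ideal -/

section ColonSequence

open CategoryTheory Module

universe u

variable {R : Type u} [CommRing R]

/-- The sequence `0 → R/(I : x) → R/I → R/(I + (x)) → 0`. The colon is an arbitrary `J` with the
right membership, so that explicit generators can be supplied. -/
theorem exists_shortExact_colon (I : Ideal R) (x : R) (J : Ideal R)
    (hJ : ∀ f, f ∈ J ↔ x * f ∈ I) :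
    ∃ S : ShortComplex (ModuleCat.{u} R), S.ShortExact ∧ S.X₁ = ModuleCat.of R (R ⧸ J) ∧
      S.X₂ = ModuleCat.of R (R ⧸ I) ∧ S.X₃ = ModuleCat.of R (R ⧸ (I ⊔ Ideal.span {x})) := by
  let f : (R ⧸ J) →ₗ[R] (R ⧸ I) :=
    Submodule.mapQ J I (LinearMap.lsmul R R x) fun y hy => (hJ y).mp hy
  let g : (R ⧸ I) →ₗ[R] (R ⧸ (I ⊔ Ideal.span {x})) := Submodule.factor le_sup_left
  have inj : Function.Injective f := by
    rw [injective_iff_map_eq_zero]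
    intro y hy
    obtain ⟨y, rfl⟩ := Submodule.Quotient.mk_surjective J y
    exact (Submodule.Quotient.mk_eq_zero _).mpr
      ((hJ y).mpr ((Submodule.Quotient.mk_eq_zero (p := I) (x := x * y)).mp hy))
  have surj : Function.Surjective g := Submodule.factor_surjective _
  have exac : Function.Exact f g := by
    intro y
    obtain ⟨y, rfl⟩ := Submodule.Quotient.mk_surjective I y
    have : g (Submodule.Quotient.mk y) = Submodule.Quotient.mk y := rfl
    rw [this, Submodule.Quotient.mk_eq_zero, Submodule.mem_sup]
    constructor
    · rintro ⟨a, ha, b, hb, rfl⟩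
      obtain ⟨c, rfl⟩ := Ideal.mem_span_singleton'.mp hb
      refine ⟨Submodule.Quotient.mk c, ?_⟩
      change Submodule.Quotient.mk (x * c) = _
      rw [Submodule.Quotient.eq, ← neg_mem_iff]
      convert ha using 1
      ring
    · rintro ⟨z, hz⟩
      obtain ⟨c, rfl⟩ := Submodule.Quotient.mk_surjective J z
      change Submodule.Quotient.mk (x * c) = _ at hz
      rw [Submodule.Quotient.eq, ← neg_mem_iff] at hz
      exact ⟨_, hz, x * c, Ideal.mul_mem_right _ _ (Ideal.mem_span_singleton_self x), by ring⟩
  exact ⟨ModuleCat.shortComplexOfCompEqZero f g exac.linearMap_comp_eq_zero,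
    ModuleCat.shortComplex_shortExact _ exac inj surj, rfl, rfl, rfl⟩

theorem hasProjectiveDimensionLE_of_colon (I : Ideal R) (x : R) (J : Ideal R)
    (hJ : ∀ f, f ∈ J ↔ x * f ∈ I) (d : ℕ)
    (h₁ : HasProjectiveDimensionLE (ModuleCat.of R (R ⧸ J)) d)
    (h₃ : HasProjectiveDimensionLE (ModuleCat.of R (R ⧸ (I ⊔ Ideal.span {x}))) d) :
    HasProjectiveDimensionLE (ModuleCat.of R (R ⧸ I)) d := by
  obtain ⟨S, hS, e₁, e₂, e₃⟩ := exists_shortExact_colon I x J hJ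
  rw [← e₁] at h₁
  rw [← e₃] at h₃
  rw [← e₂]
  exact hS.hasProjectiveDimensionLT_X₂ _ h₁ h₃

theorem hasProjectiveDimensionLE_sup_span_singleton (I : Ideal R) (x : R)
    (hx : ∀ f, x * f ∈ I → f ∈ I) (d : ℕ)
    (h : HasProjectiveDimensionLE (ModuleCat.of R (R ⧸ I)) d) :
    HasProjectiveDimensionLE (ModuleCat.of R (R ⧸ (I ⊔ Ideal.span {x}))) (d + 1) := by
  obtain ⟨S, hS, e₁, e₂, e₃⟩ :=
    exists_shortExact_colon I x I fun f => ⟨I.mul_mem_left x, hx f⟩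
  have h₂ := h
  rw [← e₁] at h
  rw [← e₂] at h₂
  rw [← e₃]
  exact hS.hasProjectiveDimensionLT_X₃ _ h (hasProjectiveDimensionLT_of_ge _ (d + 1) _ (by omega))

end ColonSequence

/-! ### Edge ideals under deletion of vertices and neighbourhoods -/

section MonomialIdeals

open MvPolynomial

variable {σ : Type*} (k : Type*) [Field k]

/-- The ideal generated by the edges of `H` with both ends in `A` and by the variables in `N`. -/
noncomputable def edgeVarIdeal (H : SimpleGraph σ) (A N : Set σ) : Ideal (MvPolynomial σ k) :=
  Ideal.span ((fun s => monomial s (1 : k)) ''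
    ({s | ∃ u ∈ A, ∃ v ∈ A, H.Adj u v ∧ s = Finsupp.single u 1 + Finsupp.single v 1} ∪
      {s | ∃ v ∈ N, s = Finsupp.single v 1}))

variable {k} {H : SimpleGraph σ} {A N : Set σ}

theorem mem_edgeVarIdeal {f : MvPolynomial σ k} : f ∈ edgeVarIdeal k H A N ↔
    ∀ m ∈ f.support, (∃ u ∈ A, ∃ v ∈ A, H.Adj u v ∧ m u ≠ 0 ∧ m v ≠ 0) ∨ ∃ v ∈ N, m v ≠ 0 := by
  classical
  rw [edgeVarIdeal, mem_ideal_span_monomial_image]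
  refine forall₂_congr fun m _ => ?_
  constructor
  · rintro ⟨s, ⟨u, hu, v, hv, huv, rfl⟩ | ⟨v, hv, rfl⟩, hs⟩
    · refine .inl ⟨u, hu, v, hv, huv, ?_, ?_⟩
      · have := hs u
        simp only [Finsupp.add_apply, Finsupp.single_eq_same] at this
        omega
      · have := hs v
        simp only [Finsupp.add_apply, Finsupp.single_eq_same] at this
        omega
    · refine .inr ⟨v, hv, ?_⟩
      have := hs v
      simp only [Finsupp.single_eq_same] at this
      omega
  · rintro (⟨u, hu, v, hv, huv, hmu, hmv⟩ | ⟨v, hv, hmv⟩)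
    · refine ⟨_, .inl ⟨u, hu, v, hv, huv, rfl⟩, fun w => ?_⟩
      have := huv.ne
      simp only [Finsupp.add_apply, Finsupp.single_apply]
      split_ifs with h1 h2 h2
      · exact absurd (h1.trans h2.symm) this
      · subst h1; omega
      · subst h2; omega
      · omega
    · refine ⟨_, .inr ⟨v, hv, rfl⟩, ?_⟩
      rw [Finsupp.single_le_iff]
      omega

theorem X_mul_mem_edgeVarIdeal {f : MvPolynomial σ k} {x : σ} :
    X x * f ∈ edgeVarIdeal k H A N ↔ ∀ m ∈ f.support,
      (∃ u ∈ A, ∃ v ∈ A, H.Adj u v ∧ (u = x ∨ m u ≠ 0) ∧ (v = x ∨ m v ≠ 0)) ∨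
        ∃ v ∈ N, v = x ∨ m v ≠ 0 := by
  classical
  have key (m : σ →₀ ℕ) (u : σ) :
      (Finsupp.single x 1 + m : σ →₀ ℕ) u ≠ 0 ↔ u = x ∨ m u ≠ 0 := by
    rw [Finsupp.add_apply, Finsupp.single_apply]
    split_ifs with h
    · simp [h]
    · simp [Ne.symm h]
  rw [mem_edgeVarIdeal, support_X_mul]
  simp only [Finset.forall_mem_map, addLeftEmbedding_apply, key]

theorem edgeVarIdeal_sup_span_X (x : σ) :
    edgeVarIdeal k H A N ⊔ Ideal.span {X x} = edgeVarIdeal k H A (insert x N) := by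
  rw [edgeVarIdeal, edgeVarIdeal, X, ← Ideal.span_union, ← Set.image_singleton
    (f := fun s => monomial s (1 : k)), ← Set.image_union, Set.union_assoc]
  congr 3
  ext s
  simp

/-- Edges through `x` are redundant once the variable of `x` is a generator. -/
theorem edgeVarIdeal_singleton (x : σ) :
    edgeVarIdeal k H A {x} = edgeVarIdeal k H (A \ {x}) {x} := by
  ext f
  simp only [mem_edgeVarIdeal]
  refine forall₂_congr fun m _ => ⟨?_, ?_⟩
  · rintro (⟨u, hu, v, hv, huv, hmu, hmv⟩ | h)
    · by_cases hux : u = x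
      · exact .inr ⟨x, rfl, hux ▸ hmu⟩
      by_cases hvx : v = x
      · exact .inr ⟨x, rfl, hvx ▸ hmv⟩
      exact .inl ⟨u, ⟨hu, hux⟩, v, ⟨hv, hvx⟩, huv, hmu, hmv⟩
    · exact .inr h
  · rintro (⟨u, hu, v, hv, h⟩ | h)
    · exact .inl ⟨u, hu.1, v, hv.1, h⟩
    · exact .inr h

theorem mem_edgeVarIdeal_of_X_mul_mem {x : σ} (hA : x ∉ A) (hN : x ∉ N)
    (f : MvPolynomial σ k) (hf : X x * f ∈ edgeVarIdeal k H A N) : f ∈ edgeVarIdeal k H A N := by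
  rw [X_mul_mem_edgeVarIdeal] at hf
  rw [mem_edgeVarIdeal]
  intro m hm
  rcases hf m hm with ⟨u, hu, v, hv, huv, hmu, hmv⟩ | ⟨v, hv, hmv⟩
  · exact .inl ⟨u, hu, v, hv, huv, hmu.resolve_left fun h => hA (h ▸ hu),
      hmv.resolve_left fun h => hA (h ▸ hv)⟩
  · exact .inr ⟨v, hv, hmv.resolve_left fun h => hN (h ▸ hv)⟩

/-- The colon by `x`: an edge at `x` leaves its other end as a generator, and this absorbs all edges
meeting `N(x)`. -/
theorem mem_edgeVarIdeal_diff_iff {x : σ} (hx : x ∈ A) (f : MvPolynomial σ k) :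
    f ∈ edgeVarIdeal k H {v ∈ A | v ≠ x ∧ ¬ H.Adj x v} {v ∈ A | H.Adj x v} ↔
      X x * f ∈ edgeVarIdeal k H A ∅ := by
  rw [X_mul_mem_edgeVarIdeal, mem_edgeVarIdeal]
  refine forall₂_congr fun m _ => ⟨?_, ?_⟩
  · rintro (⟨u, hu, v, hv, huv, hmu, hmv⟩ | ⟨v, hv, hmv⟩)
    · exact .inl ⟨u, hu.1, v, hv.1, huv, .inr hmu, .inr hmv⟩
    · exact .inl ⟨x, hx, v, hv.1, hv.2, .inl rfl, .inr hmv⟩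
  · rintro (⟨u, hu, v, hv, huv, hmu, hmv⟩ | ⟨v, hv, hmv⟩)
    · rcases hmu with rfl | hmu
      · exact .inr ⟨v, ⟨hv, huv⟩, hmv.resolve_left huv.ne'⟩
      rcases hmv with rfl | hmv
      · exact .inr ⟨u, ⟨hu, huv.symm⟩, hmu⟩
      by_cases hxu : H.Adj x u
      · exact .inr ⟨u, ⟨hu, hxu⟩, hmu⟩
      by_cases hxv : H.Adj x v
      · exact .inr ⟨v, ⟨hv, hxv⟩, hmv⟩
      refine .inl ⟨u, ⟨hu, ?_, hxu⟩, v, ⟨hv, ?_, hxv⟩, huv, hmu, hmv⟩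
      · rintro rfl
        exact hxv huv
      · rintro rfl
        exact hxu huv.symm
    · exact hv.elim

open CategoryTheory

theorem hasProjectiveDimensionLE_edgeVarIdeal_add_card (N : Finset σ)
    (hN : ∀ v ∈ N, v ∉ A) (d : ℕ)
    (h : HasProjectiveDimensionLE
      (ModuleCat.of (MvPolynomial σ k) (MvPolynomial σ k ⧸ edgeVarIdeal k H A ∅)) d) :
    HasProjectiveDimensionLE
      (ModuleCat.of (MvPolynomial σ k) (MvPolynomial σ k ⧸ edgeVarIdeal k H A N))
        (d + N.card) := by
  classical
  induction N using Finset.induction_on with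
  | empty => rwa [Finset.coe_empty, Finset.card_empty, add_zero]
  | insert x N hx ih =>
    simp only [Finset.mem_insert, forall_eq_or_imp] at hN
    rw [Finset.card_insert_of_notMem hx, ← add_assoc, Finset.coe_insert,
      ← edgeVarIdeal_sup_span_X]
    exact hasProjectiveDimensionLE_sup_span_singleton _ _
      (mem_edgeVarIdeal_of_X_mul_mem hN.1 (by simpa using hx)) _ (ih hN.2)

/-- The projective dimension of an edge ideal is controlled by deleting a vertex and by
deleting its closed neighbourhood. -/
theorem hasProjectiveDimensionLE_edgeVarIdeal_of_mem {x : σ} (hx : x ∈ A) (N : Finset σ)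
    (hN : ∀ v, v ∈ N ↔ v ∈ A ∧ H.Adj x v) (d e : ℕ)
    (h₁ : HasProjectiveDimensionLE (ModuleCat.of (MvPolynomial σ k)
      (MvPolynomial σ k ⧸ edgeVarIdeal k H (A \ {x}) ∅)) d)
    (h₂ : HasProjectiveDimensionLE (ModuleCat.of (MvPolynomial σ k)
      (MvPolynomial σ k ⧸ edgeVarIdeal k H {v ∈ A | v ≠ x ∧ ¬ H.Adj x v} ∅)) e)
    (he : e + N.card ≤ d + 1) :
    HasProjectiveDimensionLE (ModuleCat.of (MvPolynomial σ k)
      (MvPolynomial σ k ⧸ edgeVarIdeal k H A ∅)) (d + 1) := by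
  refine hasProjectiveDimensionLE_of_colon _ (X x) _ (mem_edgeVarIdeal_diff_iff hx) _ ?_ ?_
  · have := hasProjectiveDimensionLE_edgeVarIdeal_add_card N
      (fun v hv h => h.2.2 ((hN v).mp hv).2) e h₂
    rw [show (N : Set σ) = {v ∈ A | H.Adj x v} from Set.ext hN] at this
    exact hasProjectiveDimensionLT_of_ge _ _ _ (Nat.succ_le_succ he)
  · have := hasProjectiveDimensionLE_sup_span_singleton _ (X x)
      (mem_edgeVarIdeal_of_X_mul_mem (x := x) (by simp) (by simp)) _ h₁
    rwa [edgeVarIdeal_sup_span_X, insert_empty_eq, ← edgeVarIdeal_singleton,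
      ← insert_empty_eq, ← edgeVarIdeal_sup_span_X] at this

theorem hasProjectiveDimensionLE_edgeVarIdeal_of_forall_not_adj
    (hA : ∀ u ∈ A, ∀ v ∈ A, ¬ H.Adj u v) (d : ℕ) :
    HasProjectiveDimensionLE (ModuleCat.of (MvPolynomial σ k)
      (MvPolynomial σ k ⧸ edgeVarIdeal k H A ∅)) d := by
  have hbot : edgeVarIdeal k H A ∅ = ⊥ := by
    rw [eq_bot_iff]
    intro f hf
    rw [mem_edgeVarIdeal] at hf
    rw [Ideal.mem_bot, ← support_eq_empty, Finset.eq_empty_iff_forall_notMem]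
    intro m hm
    rcases hf m hm with ⟨u, hu, v, hv, huv, -⟩ | ⟨v, hv, -⟩
    · exact hA u hu v hv huv
    · exact hv
  rw [hbot]
  have : Module.Projective (MvPolynomial σ k) (MvPolynomial σ k ⧸ (⊥ : Ideal (MvPolynomial σ k))) :=
    Module.Projective.of_equiv (Submodule.quotEquivOfEqBot ⊥ rfl).symm
  have : Projective (ModuleCat.of (MvPolynomial σ k)
    (MvPolynomial σ k ⧸ (⊥ : Ideal (MvPolynomial σ k)))) := inferInstance
  exact hasProjectiveDimensionLT_of_ge _ 1 _ (by omega)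

end MonomialIdeals

/-! ### Ideals generated by variables -/

section VariableIdeals

open MvPolynomial RingTheory.Sequence

variable {σ : Type*} {k : Type*} [Field k]

theorem X_mem_span_X_image_iff {C : Set σ} {v : σ} :
    (X v : MvPolynomial σ k) ∈ Ideal.span (X '' C) ↔ v ∈ C := by
  classical
  rw [mem_ideal_span_X_image, support_X]
  simp [Finsupp.single_apply]

theorem mem_span_X_image_of_X_mul_mem {C : Set σ} {v : σ} (hv : v ∉ C) (f : MvPolynomial σ k)
    (hf : X v * f ∈ Ideal.span (X '' C : Set (MvPolynomial σ k))) :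
    f ∈ Ideal.span (X '' C : Set (MvPolynomial σ k)) := by
  classical
  rw [mem_ideal_span_X_image, support_X_mul] at hf
  rw [mem_ideal_span_X_image]
  intro m hm
  obtain ⟨i, hi, him⟩ := hf _ (Finset.mem_map_of_mem _ hm)
  have : v ≠ i := fun h => hv (h ▸ hi)
  exact ⟨i, hi, by simpa [Finsupp.single_apply, this] using him⟩

/-- It is the kernel of the endomorphism `φ` sending the variables in `C` to zero and fixing the
others, as `f ≡ φ f` modulo the ideal. -/
theorem isPrime_span_X_image (C : Set σ) :
    (Ideal.span (X '' C : Set (MvPolynomial σ k))).IsPrime := by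
  classical
  let φ : MvPolynomial σ k →ₐ[k] MvPolynomial σ k := aeval fun v => if v ∈ C then 0 else X v
  have hφ (f : MvPolynomial σ k) : f - φ f ∈ Ideal.span (X '' C : Set (MvPolynomial σ k)) := by
    rw [← Ideal.Quotient.mk_eq_mk_iff_sub_mem]
    have : (Ideal.Quotient.mkₐ k (Ideal.span (X '' C : Set (MvPolynomial σ k)))) =
        (Ideal.Quotient.mkₐ k _).comp φ := by
      ext v
      simp only [φ, AlgHom.comp_apply, aeval_X]
      split_ifs with h
      · rw [map_zero]
        exact Ideal.Quotient.eq_zero_iff_mem.mpr (X_mem_span_X_image_iff.mpr h)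
      · rfl
    exact DFunLike.congr_fun this f
  have hker : Ideal.span (X '' C : Set (MvPolynomial σ k)) = RingHom.ker φ := by
    refine le_antisymm (Ideal.span_le.mpr ?_) fun f hf => ?_
    · rintro _ ⟨v, hv, rfl⟩
      simp [φ, RingHom.mem_ker, hv]
    · have := hφ f
      rwa [RingHom.mem_ker.mp hf, sub_zero] at this
  rw [hker]
  exact RingHom.ker_isPrime _

theorem card_le_height_span_X_image (C : Finset σ) :
    (C.card : ℕ∞) ≤ (Ideal.span (X '' (C : Set σ) : Set (MvPolynomial σ k))).height := by
  classical
  induction C using Finset.induction_on with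
  | empty => simp
  | insert x C hx ih =>
    have h₁ := isPrime_span_X_image (k := k) (C : Set σ)
    have h₂ := isPrime_span_X_image (k := k) ((insert x C : Finset σ) : Set σ)
    have hlt : Ideal.span (X '' (C : Set σ) : Set (MvPolynomial σ k)) <
        Ideal.span (X '' ((insert x C : Finset σ) : Set σ)) := by
      refine lt_of_le_of_ne (Ideal.span_mono (Set.image_mono (by simp))) fun h => hx ?_
      have : (X x : MvPolynomial σ k) ∈ Ideal.span (X '' ((insert x C : Finset σ) : Set σ)) :=
        X_mem_span_X_image_iff.mpr (by simp)
      rw [← h, X_mem_span_X_image_iff] at this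
      simpa using this
    rw [Finset.card_insert_of_notMem hx, Nat.cast_add, Nat.cast_one]
    exact (add_le_add_left ih 1).trans (Ideal.height_add_one_le_of_lt_of_isPrime hlt)

theorem height_span_X_image_le_card [Finite σ] (C : Finset σ) :
    (Ideal.span (X '' (C : Set σ) : Set (MvPolynomial σ k))).height ≤ C.card := by
  classical
  have := isPrime_span_X_image (k := k) (C : Set σ)
  have h := Ideal.height_le_card_of_mem_minimalPrimes_span_finset
    (p := Ideal.span (X '' (C : Set σ) : Set (MvPolynomial σ k)))
    (s := C.image (X : σ → MvPolynomial σ k))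
    (by rw [Finset.coe_image, Ideal.minimalPrimes_eq_subsingleton_self]; rfl)
  exact h.trans (by exact_mod_cast Finset.card_image_le)

theorem isWeaklyRegular_map_X (l : List σ) (hl : l.Nodup) :
    IsWeaklyRegular (MvPolynomial σ k) (l.map (X : σ → MvPolynomial σ k)) := by
  induction l using List.reverseRecOn with
  | nil => simp
  | append_singleton l x ih =>
    rw [List.nodup_append] at hl
    rw [List.map_append, isWeaklyRegular_append_iff, List.map_singleton,
      isWeaklyRegular_singleton_iff]
    refine ⟨ih hl.1, ?_⟩
    have hspan : Ideal.ofList (l.map (X : σ → MvPolynomial σ k)) • (⊤ : Ideal (MvPolynomial σ k)) =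
        Ideal.span (X '' {v | v ∈ l}) := by
      rw [smul_eq_mul, Ideal.mul_top, Ideal.ofList]
      congr 1
      ext
      simp
    rw [hspan, isSMulRegular_iff_right_eq_zero_of_smul]
    intro f hf
    obtain ⟨f, rfl⟩ := Submodule.Quotient.mk_surjective _ f
    rw [← Submodule.Quotient.mk_smul, Submodule.Quotient.mk_eq_zero] at hf
    rw [Submodule.Quotient.mk_eq_zero]
    exact mem_span_X_image_of_X_mul_mem (C := {v | v ∈ l}) (v := x)
      (fun h => hl.2.2 x h x (by simp) rfl) f hf

end VariableIdeals

/-! ### Minimal primes of edge ideals and the lower bound -/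

section EdgeIdeals

open MvPolynomial CategoryTheory

variable {σ : Type*} {k : Type*} [Field k] {H : SimpleGraph σ}

theorem edgeIdeal_eq_edgeVarIdeal : edgeIdeal k H = edgeVarIdeal k H Set.univ ∅ := by
  rw [edgeIdeal, edgeVarIdeal]
  congr 1
  ext f
  simp only [Set.mem_ofPred_eq, Set.mem_image, Set.mem_union, Set.mem_univ, true_and,
    Set.mem_empty_iff_false, false_and, exists_false, or_false, X, monomial_mul, one_mul]
  constructor
  · rintro ⟨u, v, h, rfl⟩
    exact ⟨_, ⟨u, v, h, rfl⟩, rfl⟩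
  · rintro ⟨_, ⟨u, v, h, rfl⟩, rfl⟩
    exact ⟨u, v, h, rfl⟩

theorem edgeIdeal_le_iff {P : Ideal (MvPolynomial σ k)} (hP : P.IsPrime) :
    edgeIdeal k H ≤ P ↔ ∀ u v, H.Adj u v → X u ∈ P ∨ X v ∈ P := by
  rw [edgeIdeal, Ideal.span_le]
  constructor
  · exact fun h u v huv => hP.mem_or_mem (h ⟨u, v, huv, rfl⟩)
  · rintro h _ ⟨u, v, huv, rfl⟩
    rcases h u v huv with h | h
    · exact P.mul_mem_right _ h
    · exact P.mul_mem_left _ h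

theorem eq_span_X_of_mem_minimalPrimes {P : Ideal (MvPolynomial σ k)}
    (hP : P ∈ (edgeIdeal k H).minimalPrimes) : P = Ideal.span (X '' {v | X v ∈ P}) := by
  have hle : Ideal.span (X '' {v | X v ∈ P}) ≤ P := by
    rw [Ideal.span_le]
    rintro _ ⟨v, hv, rfl⟩
    exact hv
  have hprime := isPrime_span_X_image (k := k) {v | X v ∈ P}
  refine le_antisymm (hP.2 ⟨hprime, (edgeIdeal_le_iff hprime).mpr fun u v huv => ?_⟩ hle) hle
  simp only [X_mem_span_X_image_iff]
  exact (edgeIdeal_le_iff hP.1.1).mp hP.1.2 u v huv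

/-- Each `v ∈ C` has an edge to some `u ∉ C`; a smaller prime over the edge ideal omits `X u`, hence
contains `X v`. -/
theorem span_X_mem_minimalPrimes {C : Set σ} (hC : ∀ u v, H.Adj u v → u ∈ C ∨ v ∈ C)
    (hmin : ∀ v ∈ C, ∃ u, u ∉ C ∧ H.Adj v u) :
    Ideal.span (X '' C) ∈ (edgeIdeal k H).minimalPrimes := by
  have hprime := isPrime_span_X_image (k := k) C
  refine ⟨⟨hprime, (edgeIdeal_le_iff hprime).mpr fun u v huv => ?_⟩, fun Q hQ hQC => ?_⟩
  · simpa only [X_mem_span_X_image_iff] using hC u v huv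
  · rw [Ideal.span_le]
    rintro _ ⟨v, hv, rfl⟩
    obtain ⟨u, hu, huv⟩ := hmin v hv
    refine ((edgeIdeal_le_iff hQ.1).mp hQ.2 v u huv).resolve_right fun h => hu ?_
    exact X_mem_span_X_image_iff.mp (hQC h)

theorem height_le_projectiveDimension_of_mem_minimalPrimes [Finite σ]
    {P : Ideal (MvPolynomial σ k)} (hP : P ∈ (edgeIdeal k H).minimalPrimes) :
    (P.height : WithBot ℕ∞) ≤ projectiveDimension (ModuleCat.of (MvPolynomial σ k)
      (MvPolynomial σ k ⧸ edgeIdeal k H)) := by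
  classical
  let C : Finset σ := (Set.toFinite {v | (X v : MvPolynomial σ k) ∈ P}).toFinset
  have hC : P = Ideal.span (X '' (C : Set σ)) := by
    rw [Set.Finite.coe_toFinset]
    exact eq_span_X_of_mem_minimalPrimes hP
  have hass : P ∈ associatedPrimes (MvPolynomial σ k) (MvPolynomial σ k ⧸ edgeIdeal k H) := by
    apply Module.associatedPrimes.minimalPrimes_annihilator_subset_associatedPrimes
    rwa [Ideal.annihilator_quotient]
  obtain ⟨hprime, m, hm⟩ := isAssociatedPrime_iff.mp hass
  have hle : (P.height : WithBot ℕ∞) ≤ (C.card : WithBot ℕ∞) := by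
    have h : P.height ≤ C.card := by
      rw [hC]
      exact height_span_X_image_le_card C
    exact_mod_cast h
  refine hle.trans ?_
  have := length_le_projectiveDimension (C.toList.map X) (isWeaklyRegular_map_X _ C.nodup_toList)
    (ModuleCat.of (MvPolynomial σ k) (MvPolynomial σ k ⧸ edgeIdeal k H)) m
    (fun h0 => hprime.ne_top (by rw [hm, h0]; simp)) (fun r hr => by
      obtain ⟨v, hv, rfl⟩ := List.mem_map.mp hr
      have hvP : X v ∈ P := by simpa [C] using hv
      rw [hm, Submodule.mem_colon_singleton] at hvP
      simpa using hvP)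
  simpa using this

end EdgeIdeals

/-! ### Covers of the whiskered graph and the upper bound -/

section CliqueWhiskered

open MvPolynomial CategoryTheory

variable {k : Type*} [Field k] {V : Type*} {G : SimpleGraph V} {r : ℕ}
  (π : CliquePartition G r) (n : Fin r → ℕ)

theorem CliquePartition.exists_mem_block (x : V) : ∃ i, x ∈ π.block i := by
  have : x ∈ ⋃ i, π.block i := by rw [π.union]; trivial
  simpa using this

/-- The vertices of `W` outside `B` together with the whiskers attached to the blocks that
meet `B`. -/
def whiskerCover (W B : Set V) : Set (V ⊕ (Σ i : Fin r, Fin (n i))) :=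
  {u | Sum.elim (fun v => v ∈ W ∧ v ∉ B) (fun w => ∃ b ∈ B, b ∈ π.block w.1) u}

/-- The vertices in `W` together with all whiskers. -/
def withWhiskers (r : ℕ) (n : Fin r → ℕ) (W : Set V) : Set (V ⊕ (Σ i : Fin r, Fin (n i))) :=
  {u | Sum.elim (fun v => v ∈ W) (fun _ => True) u}

variable {n}

theorem span_whiskerCover_mem_minimalPrimes (hn : ∀ i, 0 < n i) {B : Set V}
    (hB : ∀ u ∈ B, ∀ v ∈ B, ¬ G.Adj u v) :
    Ideal.span (X '' whiskerCover π n Set.univ B) ∈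
      (edgeIdeal k (multiCliqueWhiskered π n)).minimalPrimes := by
  refine span_X_mem_minimalPrimes ?_ ?_
  · rintro (u | w) (v | w') h
    · by_cases hu : u ∈ B
      · exact .inr ⟨trivial, fun hv => hB u hu v hv h⟩
      · exact .inl ⟨trivial, hu⟩
    · by_cases hu : u ∈ B
      · exact .inr ⟨u, hu, h⟩
      · exact .inl ⟨trivial, hu⟩
    · by_cases hv : v ∈ B
      · exact .inl ⟨v, hv, h⟩
      · exact .inr ⟨trivial, hv⟩
    · exact h.elim
  · rintro (v | w) h
    · obtain ⟨i, hi⟩ := π.exists_mem_block v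
      by_cases hb : ∃ b ∈ B, b ∈ π.block i
      -- The neighbour outside the cover is `b`, as the block is a clique; if the block misses `B`,
      -- it is a whisker, which exists because `0 < n i`.
      · obtain ⟨b, hb, hbi⟩ := hb
        refine ⟨.inl b, fun h' => h'.2 hb, π.isClique i hi hbi ?_⟩
        rintro rfl
        exact h.2 hb
      · exact ⟨.inr ⟨i, 0, hn i⟩, hb, hi⟩
    · obtain ⟨b, hb, hbi⟩ := h
      exact ⟨.inl b, fun h' => h'.2 hb, hbi⟩

/-- The right side restores the whiskers at the block of `x`. They are isolated there: their
neighbours lie in that clique, hence in `N[x]`. -/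
theorem edgeVarIdeal_withWhiskers_closedNeighbor {W : Set V} {x : V} :
    edgeVarIdeal k (multiCliqueWhiskered π n) {v ∈ withWhiskers r n W |
        v ≠ Sum.inl x ∧ ¬ (multiCliqueWhiskered π n).Adj (Sum.inl x) v} ∅ =
      edgeVarIdeal k (multiCliqueWhiskered π n)
        (withWhiskers r n {v ∈ W | v ≠ x ∧ ¬ G.Adj x v}) ∅ := by
  have key (v : V) (w : Σ i : Fin r, Fin (n i)) (hv : v ≠ x ∧ ¬ G.Adj x v)
      (hvw : v ∈ π.block w.1) : x ∉ π.block w.1 :=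
    fun hx => hv.2 (π.isClique _ hx hvw hv.1.symm)
  ext f
  simp only [mem_edgeVarIdeal]
  refine forall₂_congr fun m _ => or_congr_left ⟨?_, ?_⟩
  · rintro ⟨u, hu, v, hv, huv, h⟩
    refine ⟨u, ?_, v, ?_, huv, h⟩
    · rcases u with u | u
      · exact ⟨hu.1, fun h => hu.2.1 (by rw [h]), hu.2.2⟩
      · trivial
    · rcases v with v | v
      · exact ⟨hv.1, fun h => hv.2.1 (by rw [h]), hv.2.2⟩
      · trivial
  · rintro ⟨u | u, hu, v | v, hv, huv, h⟩
    · exact ⟨.inl u, ⟨hu.1, by simpa using hu.2.1, hu.2.2⟩, .inl v,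
        ⟨hv.1, by simpa using hv.2.1, hv.2.2⟩, huv, h⟩
    · exact ⟨.inl u, ⟨hu.1, by simpa using hu.2.1, hu.2.2⟩, .inr v,
        ⟨trivial, by simp, key u v hu.2 huv⟩, huv, h⟩
    · exact ⟨.inr u, ⟨trivial, by simp, key v u hv.2 huv⟩, .inl v,
        ⟨hv.1, by simpa using hv.2.1, hv.2.2⟩, huv, h⟩
    · exact huv.elim

theorem withWhiskers_diff_singleton {W : Set V} {x : V} :
    withWhiskers r n (W \ {x}) = withWhiskers r n W \ {Sum.inl x} := by
  ext (v | w) <;> simp [withWhiskers]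

theorem hasProjectiveDimensionLE_withWhiskers [Finite V] (W : Set V) (d : ℕ)
    (hd : ∀ B ⊆ W, (∀ u ∈ B, ∀ v ∈ B, ¬ G.Adj u v) → (whiskerCover π n W B).ncard ≤ d) :
    HasProjectiveDimensionLE (ModuleCat.of (MvPolynomial (V ⊕ (Σ i : Fin r, Fin (n i))) k)
      (MvPolynomial (V ⊕ (Σ i : Fin r, Fin (n i))) k ⧸
        edgeVarIdeal k (multiCliqueWhiskered π n) (withWhiskers r n W) ∅)) d := by
  induction hc : W.ncard using Nat.strong_induction_on generalizing W d with
  | _ c ih =>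
    subst hc
    rcases W.eq_empty_or_nonempty with rfl | ⟨x, hx⟩
    · refine hasProjectiveDimensionLE_edgeVarIdeal_of_forall_not_adj ?_ d
      rintro (u | u) hu (v | v) hv
      · exact hu.elim
      · exact hu.elim
      · exact hv.elim
      · exact id
    -- Independent sets avoiding `x`: restoring `x` to `W` adds `x` to the cover.
    have hdel (B : Set V) (hBW : B ⊆ W \ {x}) (hB : ∀ u ∈ B, ∀ v ∈ B, ¬ G.Adj u v) :
        (whiskerCover π n (W \ {x}) B).ncard + 1 ≤ d := by
      refine le_trans ?_ (hd B (hBW.trans Set.sdiff_subset) hB)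
      rw [← Set.ncard_insert_of_notMem (a := Sum.inl x) (fun h => h.1.2 rfl)]
      refine Set.ncard_le_ncard (Set.insert_subset ⟨hx, fun h => (hBW h).2 rfl⟩ ?_)
      rintro (v | w) h
      · exact ⟨h.1.1, h.2⟩
      · exact h
    obtain ⟨d, rfl⟩ : ∃ e, d = e + 1 := by
      have := hdel ∅ (Set.empty_subset _) (by simp)
      exact ⟨d - 1, by omega⟩
    let N : Set (V ⊕ (Σ i : Fin r, Fin (n i))) :=
      {v ∈ withWhiskers r n W | (multiCliqueWhiskered π n).Adj (Sum.inl x) v}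
    let W' : Set V := {v ∈ W | v ≠ x ∧ ¬ G.Adj x v}
    -- Independent sets containing `x`: the cover for `insert x B` contains `N`, disjointly from the
    -- cover for `B` in `W'`.
    have hnbr (B : Set V) (hBW : B ⊆ W') (hB : ∀ u ∈ B, ∀ v ∈ B, ¬ G.Adj u v) :
        (whiskerCover π n W' B).ncard + N.ncard ≤ d + 1 := by
      refine le_trans ?_ (hd (insert x B) (Set.insert_subset hx fun b hb => (hBW hb).1) ?_)
      · rw [← Set.ncard_union_eq]
        · refine Set.ncard_le_ncard (Set.union_subset ?_ ?_)
          · rintro (v | w) h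
            · refine ⟨h.1.1, fun h' => h'.elim (fun h' => h.1.2.1 h') h.2⟩
            · obtain ⟨b, hb, hbw⟩ := h
              exact ⟨b, .inr hb, hbw⟩
          · rintro (v | w) h
            · refine ⟨h.1, fun h' => h'.elim (fun h' => ?_) fun h' => (hBW h').2.2 h.2⟩
              subst h'
              exact G.irrefl h.2
            · exact ⟨x, .inl rfl, h.2⟩
        · rw [Set.disjoint_left]
          rintro (v | w) h h'
          · exact h.1.2.2 h'.2
          · obtain ⟨b, hb, hbw⟩ := h
            exact (hBW hb).2.2 (π.isClique _ h'.2 hbw (hBW hb).2.1.symm)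
      · rintro u (rfl | hu) v (rfl | hv)
        · exact G.irrefl
        · exact (hBW hv).2.2
        · exact fun h => (hBW hu).2.2 h.symm
        · exact hB u hu v hv
    have hN : N.ncard ≤ d + 1 := by
      have := hnbr ∅ (Set.empty_subset _) (by simp)
      omega
    have hx' : Sum.inl x ∈ withWhiskers r n W := hx
    refine hasProjectiveDimensionLE_edgeVarIdeal_of_mem hx' N.toFinite.toFinset
      (fun v => by simp [N]) d (d + 1 - N.ncard) ?_ ?_ ?_
    · rw [← withWhiskers_diff_singleton]
      exact ih _ (Set.ncard_sdiff_singleton_lt_of_mem hx) _ _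
        (fun B hBW hB => Nat.le_of_succ_le_succ (hdel B hBW hB)) rfl
    · rw [edgeVarIdeal_withWhiskers_closedNeighbor]
      refine ih _ (Set.ncard_lt_ncard ⟨fun v hv => hv.1, fun h => (h hx).2.1 rfl⟩) _ _
        (fun B hBW hB => ?_) rfl
      exact Nat.le_sub_of_add_le (hnbr B hBW hB)
    · rw [← Set.ncard_eq_toFinset_card]
      omega

end CliqueWhiskered

theorem mainTheorem9 (k : Type*) [Field k] {V : Type*} [Finite V] (G : SimpleGraph V) (r : ℕ)
    (π : CliquePartition G r) (n : Fin r → ℕ) (hn : ∀ i, 0 < n i) :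
    CategoryTheory.projectiveDimension
        (ModuleCat.of (MvPolynomial (V ⊕ (Σ i : Fin r, Fin (n i))) k)
          (MvPolynomial (V ⊕ (Σ i : Fin r, Fin (n i))) k ⧸
            edgeIdeal k (multiCliqueWhiskered π n))) =
      ((bigHeight (edgeIdeal k (multiCliqueWhiskered π n)) : ℕ∞) : WithBot ℕ∞) := by
  apply le_antisymm
  · obtain ⟨B, hB, hmax⟩ := Set.exists_max_image {B : Set V | ∀ u ∈ B, ∀ v ∈ B, ¬ G.Adj u v}
      (fun B => (whiskerCover π n Set.univ B).ncard) (Set.toFinite _) ⟨∅, by simp⟩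
    have hpd := hasProjectiveDimensionLE_withWhiskers (k := k) π Set.univ
      (whiskerCover π n Set.univ B).ncard fun B' _ hB' => hmax B' hB'
    have huniv : withWhiskers r n (Set.univ : Set V) = Set.univ := by
      ext (v | w) <;> simp [withWhiskers]
    rw [huniv, ← edgeIdeal_eq_edgeVarIdeal, ← CategoryTheory.projectiveDimension_le_iff] at hpd
    refine hpd.trans ?_
    have hheight := card_le_height_span_X_image (k := k)
      (whiskerCover π n Set.univ B).toFinite.toFinset
    rw [Set.Finite.coe_toFinset, ← Set.ncard_eq_toFinset_card] at hheight
    have hle : ((whiskerCover π n Set.univ B).ncard : ℕ∞) ≤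
        bigHeight (edgeIdeal k (multiCliqueWhiskered π n)) :=
      hheight.trans (le_iSup₂_of_le _ (span_whiskerCover_mem_minimalPrimes π hn hB) le_rfl)
    exact_mod_cast hle
  · have hP := fun P hP => height_le_projectiveDimension_of_mem_minimalPrimes (k := k)
      (H := multiCliqueWhiskered π n) (P := P) hP
    -- One minimal prime is needed to exclude projective dimension `⊥`.
    have h₀ := hP _ (span_whiskerCover_mem_minimalPrimes (B := ∅) π hn (by simp))
    generalize CategoryTheory.projectiveDimension
      (ModuleCat.of (MvPolynomial (V ⊕ (Σ i : Fin r, Fin (n i))) k)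
        (MvPolynomial (V ⊕ (Σ i : Fin r, Fin (n i))) k ⧸
          edgeIdeal k (multiCliqueWhiskered π n))) = p at hP h₀ ⊢
    induction p with
    | bot => simp at h₀
    | coe p => exact WithBot.coe_le_coe.mpr (iSup₂_le fun P h => WithBot.coe_le_coe.mp (hP P h))
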